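/- For lattices $A$ and $B$ and $(a,b)\in A\times B$ put $$a\mathbin{\square} b=\{(x,y)\in A\times B : x\le a \text{ or } y\le b\}.$$ The box product $A\mathbin{\square} B$ is the set of all intersections of nonempty finite families of sets of the form $a\mathbin{\square} b$, ordered by inclusion; it is a lattice. Let $\bot_A$ be $\{0_A\}$ if $A$ has a zero (least element) $0_A$, and $\varnothing$ otherwise, and similarly for $B$. Put $\bot_{A,B}=(A\times\bot_B)\cup(\bot_A\times B)$ and $$a\boxtimes b=\{(x,y)\in A\times B : x\le a\text{ and }y\le b\}\cup\bot_{A,B}.$$ The lattice tensor product $A\boxtimes B$ is the sublattice of $A\mathbin{\square} B$ that consists of all $H\in A\mathbin{\square} B$ with $H\subseteq a\boxtimes b$ for some $(a,b)\in A\times B$. A lattice is simple if it has more than one element and its only congruences are equality and the full relation. A congruence-preserving embedding of a lattice $L$ into a lattice $K$ is an injective lattice homomorphism $f\colon L\to K$ such that for every congruence $\alpha$ of $L$ there is exactly one congruence $\beta$ of $K$ with, for all $x,y\in L$, $f(x)\equiv f(y)\ (\beta)$ if and only if $x\equiv y\ (\alpha)$. **Corollary.** Let $S$ and $L$ be lattices,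 and let $S$ be simple. 1. If $S$ is bounded, then $j(x)=0_S\mathbin{\square} x$, for $x\in L$, defines a congruence-preserving embedding $j\colon L\to S\boxtimes L$. 2. If both $S$ and $L$ have a zero, then for every $s\in S$ with $s\neq 0_S$, $j_s(x)=s\boxtimes x$, for $x\in L$, defines a congruence-preserving embedding $j_s\colon L\to S\boxtimes L$. -/

import Mathlib

namespace LatTensor

universe u v

section Basic

variable {A : Type u} {B : Type v} [Lattice A] [Lattice B]

/-- The set `a □ b`, of all pairs `(x, y)` with `x ≤ a` or `y ≤ b`. -/
def box (a : A) (b : B) : Set (A × B) := {p | p.1 ≤ a ∨ p.2 ≤ b}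

variable (A B) in
/-- The set `⊥_{A,B} = (A × ⊥_B) ∪ (⊥_A × B)`, where `⊥_L` is the set whose only element is the
zero of `L` if `L` has a zero, and is empty otherwise. -/
def botSet : Set (A × B) := {p | IsBot p.1 ∨ IsBot p.2}

/-- The set `a ⊠ b`, of all pairs `(x, y)` with `x ≤ a` and `y ≤ b`, together with `⊥_{A,B}`. -/
def pureTensor (a : A) (b : B) : Set (A × B) := {p | p.1 ≤ a ∧ p.2 ≤ b} ∪ botSet A B

/-- `H` is the intersection of a nonempty finite family of sets of the form `a □ b`. -/
def IsBoxMeet (H : Set (A × B)) : Prop :=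
  ∃ t : Finset (A × B), t.Nonempty ∧ H = ⋂ p ∈ t, box p.1 p.2

/-- `H` is contained in some `a ⊠ b`. -/
def IsConfined (H : Set (A × B)) : Prop := ∃ (a : A) (b : B), H ⊆ pureTensor a b

variable (A B) in
/-- The box product `A □ B`, as a set of subsets of `A × B`, ordered by inclusion. -/
abbrev BoxProduct : Type (max u v) := {H : Set (A × B) // IsBoxMeet H}

theorem isBoxMeet_box (a : A) (b : B) : IsBoxMeet (box a b) :=
  ⟨{(a, b)}, by simp, by simp⟩

theorem IsBoxMeet.inter {H K : Set (A × B)} (hH : IsBoxMeet H) (hK : IsBoxMeet K) :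
    IsBoxMeet (H ∩ K) := by
  classical
  obtain ⟨s, hs, rfl⟩ := hH
  obtain ⟨t, ht, rfl⟩ := hK
  refine ⟨s ∪ t, hs.mono Finset.subset_union_left, ?_⟩
  ext x
  simp only [Set.mem_inter_iff, Set.mem_iInter, Finset.mem_union, or_imp, forall_and]

/-- The union of `a □ b` and of finitely many rectangles. -/
def boxUnion (a : A) (b : B) (l : List (A × B)) : Set (A × B) :=
  {p | p.1 ≤ a ∨ p.2 ≤ b ∨ ∃ c ∈ l, p.1 ≤ c.1 ∧ p.2 ≤ c.2}

theorem IsBoxMeet.exists_boxUnion {H : Set (A × B)} (hH : IsBoxMeet H) :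
    ∃ a b l, H = boxUnion a b l := by
  obtain ⟨t, ht, rfl⟩ := hH
  induction ht using Finset.Nonempty.cons_induction with
  | singleton p => exact ⟨p.1, p.2, [], by ext; simp [box, boxUnion]⟩
  | cons p s hp hs ih =>
    obtain ⟨a, b, l, h⟩ := ih
    refine ⟨p.1 ⊓ a, p.2 ⊓ b, (p.1, b) :: (a, p.2) ::
      (l.map (fun c => (c.1 ⊓ p.1, c.2)) ++ l.map (fun c => (c.1, c.2 ⊓ p.2))), ?_⟩
    simp only [Finset.mem_cons, Set.iInter_iInter_eq_or_left, h]
    ext ⟨x, y⟩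
    simp only [box, boxUnion, Set.mem_inter_iff, Set.mem_ofPred_eq, List.mem_cons, List.mem_append,
      List.mem_map, le_inf_iff]
    constructor
    · rintro ⟨h1, h2 | h2 | ⟨c, hc, h2, h3⟩⟩
      · rcases h1 with h1 | h1
        · exact Or.inl ⟨h1, h2⟩
        · exact Or.inr (Or.inr ⟨_, Or.inr (Or.inl rfl), h2, h1⟩)
      · rcases h1 with h1 | h1
        · exact Or.inr (Or.inr ⟨_, Or.inl rfl, h1, h2⟩)
        · exact Or.inr (Or.inl ⟨h1, h2⟩)
      · rcases h1 with h1 | h1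
        · exact Or.inr (Or.inr ⟨_, Or.inr (Or.inr (Or.inl ⟨c, hc, rfl⟩)), le_inf h2 h1, h3⟩)
        · exact Or.inr (Or.inr ⟨_, Or.inr (Or.inr (Or.inr ⟨c, hc, rfl⟩)), h2, le_inf h3 h1⟩)
    · rintro (⟨h1, h2⟩ | ⟨h1, h2⟩ | ⟨c, rfl | rfl | ⟨d, hd, rfl⟩ | ⟨d, hd, rfl⟩, h1, h2⟩)
      · exact ⟨Or.inl h1, Or.inl h2⟩
      · exact ⟨Or.inr h1, Or.inr (Or.inl h2)⟩
      · exact ⟨Or.inl h1, Or.inr (Or.inl h2)⟩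
      · exact ⟨Or.inr h2, Or.inl h1⟩
      · exact ⟨Or.inl (h1.trans inf_le_right), Or.inr (Or.inr ⟨d, hd, h1.trans inf_le_left, h2⟩)⟩
      · exact ⟨Or.inr (h2.trans inf_le_right), Or.inr (Or.inr ⟨d, hd, h1, h2.trans inf_le_left⟩)⟩

theorem boxUnion_subset_box {a p : A} {b q : B} {l : List (A × B)} :
    boxUnion a b l ⊆ box p q ↔
      IsTop p ∨ IsTop q ∨ (a ≤ p ∧ b ≤ q ∧ ∀ c ∈ l, c.1 ≤ p ∨ c.2 ≤ q) := by
  constructor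
  · intro h
    by_contra! hc
    obtain ⟨hp, hq, hc⟩ := hc
    simp only [IsTop, not_forall] at hp hq
    obtain ⟨x, hx⟩ := hp
    obtain ⟨y, hy⟩ := hq
    have ha : a ≤ p := (h (show (a, y) ∈ boxUnion a b l from Or.inl le_rfl)).resolve_right hy
    have hb : b ≤ q := (h (show (x, b) ∈ boxUnion a b l from Or.inr (Or.inl le_rfl))).resolve_left hx
    obtain ⟨c, hcl, h1, h2⟩ := hc ha hb
    rcases h (show c ∈ boxUnion a b l from Or.inr (Or.inr ⟨c, hcl, le_rfl, le_rfl⟩)) with h3 | h3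
    · exact h1 h3
    · exact h2 h3
  · rintro (h | h | ⟨h1, h2, h3⟩) ⟨x, y⟩ hxy
    · exact Or.inl (h x)
    · exact Or.inr (h y)
    · rcases hxy with hx | hy | ⟨c, hc, hx, hy⟩
      · exact Or.inl (le_trans hx h1)
      · exact Or.inr (le_trans hy h2)
      · exact (h3 c hc).imp (le_trans hx) (le_trans hy)

theorem exists_closure (l : List (A × B)) : ∀ (a : A) (b : B), ∃ K, IsBoxMeet K ∧
    ∀ p q, boxUnion a b l ⊆ box p q ↔ K ⊆ box p q := by
  suffices h : ∀ (a : A) (b : B), ∃ K, IsBoxMeet K ∧ boxUnion a b l ⊆ K ∧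
      ∀ p q, boxUnion a b l ⊆ box p q → K ⊆ box p q by
    intro a b
    obtain ⟨K, h1, h2, h3⟩ := h a b
    exact ⟨K, h1, fun p q => ⟨h3 p q, h2.trans⟩⟩
  induction l with
  | nil =>
    intro a b
    have h : boxUnion a b [] = box a b := by ext; simp [box, boxUnion]
    exact ⟨box a b, isBoxMeet_box a b, h.subset, fun p q hpq => h ▸ hpq⟩
  | cons c l ih =>
    intro a b
    obtain ⟨K, hK, hK1, hK2⟩ := ih (a ⊔ c.1) b
    obtain ⟨M, hM, hM1, hM2⟩ := ih a (b ⊔ c.2)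
    refine ⟨K ∩ M, hK.inter hM, ?_, ?_⟩
    · rintro ⟨x, y⟩ hxy
      refine ⟨hK1 ?_, hM1 ?_⟩
      · rcases hxy with hx | hy | ⟨d, hd, hx, hy⟩
        · exact Or.inl (le_sup_of_le_left hx)
        · exact Or.inr (Or.inl hy)
        · rcases List.mem_cons.1 hd with rfl | hd
          · exact Or.inl (le_sup_of_le_right hx)
          · exact Or.inr (Or.inr ⟨d, hd, hx, hy⟩)
      · rcases hxy with hx | hy | ⟨d, hd, hx, hy⟩
        · exact Or.inl hx
        · exact Or.inr (Or.inl (le_sup_of_le_left hy))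
        · rcases List.mem_cons.1 hd with rfl | hd
          · exact Or.inr (Or.inl (le_sup_of_le_right hy))
          · exact Or.inr (Or.inr ⟨d, hd, hx, hy⟩)
    · intro p q hpq
      rw [boxUnion_subset_box] at hpq
      rcases hpq with h | h | ⟨h1, h2, h3⟩
      · exact fun z _ => Or.inl (h z.1)
      · exact fun z _ => Or.inr (h z.2)
      · have h4 := fun d hd => h3 d (List.mem_cons_of_mem c hd)
        rcases h3 c List.mem_cons_self with h | h
        · exact Set.inter_subset_left.trans
            (hK2 p q (boxUnion_subset_box.2 (Or.inr (Or.inr ⟨sup_le h1 h, h2, h4⟩))))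
        · exact Set.inter_subset_right.trans
            (hM2 p q (boxUnion_subset_box.2 (Or.inr (Or.inr ⟨h1, sup_le h2 h, h4⟩))))

/-- The least member of the box product that contains `H ∪ K`. -/
def joinSet (H K : Set (A × B)) : Set (A × B) := ⋂₀ {M | IsBoxMeet M ∧ H ∪ K ⊆ M}

theorem subset_of_forall_box {H M K : Set (A × B)} (hM : IsBoxMeet M) (hHM : H ⊆ M)
    (h : ∀ p q, H ⊆ box p q → K ⊆ box p q) : K ⊆ M := by
  obtain ⟨t, -, rfl⟩ := hM
  exact Set.subset_iInter₂ fun p hp =>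
    h _ _ (hHM.trans (Set.biInter_subset_of_mem (t := fun p : A × B => box p.1 p.2) hp))

theorem IsBoxMeet.joinSet {H K : Set (A × B)} (hH : IsBoxMeet H) (hK : IsBoxMeet K) :
    IsBoxMeet (joinSet H K) := by
  obtain ⟨a, b, l, hl⟩ := hH.exists_boxUnion
  obtain ⟨c, d, m, hm⟩ := hK.exists_boxUnion
  obtain ⟨M, hM, h⟩ := exists_closure (l ++ m) (a ⊔ c) (b ⊔ d)
  have key : ∀ p q, H ∪ K ⊆ box p q ↔ M ⊆ box p q := by
    intro p q
    rw [← h, Set.union_subset_iff, hl, hm]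
    simp only [boxUnion_subset_box, sup_le_iff, List.mem_append, or_imp, forall_and]
    tauto
  have hHK : H ∪ K ⊆ M := subset_of_forall_box hM subset_rfl fun p q => (key p q).2
  have : LatTensor.joinSet H K = M := by
    apply Set.Subset.antisymm
    · exact Set.sInter_subset_of_mem ⟨hM, hHK⟩
    · exact Set.subset_sInter fun N hN =>
        subset_of_forall_box hN.1 hN.2 fun p q => (key p q).1
  rwa [this]

/-- The box product is a lattice: meets are intersections, and the join of two members is the least
member that contains both. -/
instance : Lattice (BoxProduct A B) where
  inf H K := ⟨H.1 ∩ K.1, H.2.inter K.2⟩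
  inf_le_left _ _ := Set.inter_subset_left
  inf_le_right _ _ := Set.inter_subset_right
  le_inf _ _ _ h h' := Set.subset_inter h h'
  sup H K := ⟨joinSet H.1 K.1, H.2.joinSet K.2⟩
  le_sup_left _ _ := Set.subset_sInter fun _ h => Set.subset_union_left.trans h.2
  le_sup_right _ _ := Set.subset_sInter fun _ h => Set.subset_union_right.trans h.2
  sup_le _ _ M h h' := Set.sInter_subset_of_mem ⟨M.2, Set.union_subset h h'⟩

theorem isBot_iff_le {T : Type*} [Lattice T] {z x : T} (hz : IsBot z) : IsBot x ↔ x ≤ z :=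
  ⟨fun hx => hx _, fun hx w => hx.trans (hz w)⟩

theorem isBoxMeet_pureTensor {H : Set (A × B)} (hH : IsBoxMeet H) {a : A} {b : B}
    (h : H ⊆ pureTensor a b) : IsBoxMeet (pureTensor a b) := by
  obtain ⟨c, d, l, rfl⟩ := hH.exists_boxUnion
  have hA : (∃ z : B, IsBot z) ∨ IsTop a := by
    by_contra! hc
    obtain ⟨hz, ha⟩ := hc
    simp only [IsTop, not_forall] at ha
    obtain ⟨x, hx⟩ := ha
    rcases h (show (x ⊔ a, d) ∈ boxUnion c d l from Or.inr (Or.inl le_rfl)) with h1 | h1 | h1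
    · exact hx (le_sup_left.trans h1.1)
    · exact hx (le_sup_left.trans (h1 a))
    · exact hz d h1
  have hB : (∃ z : A, IsBot z) ∨ IsTop b := by
    by_contra! hc
    obtain ⟨hz, hb⟩ := hc
    simp only [IsTop, not_forall] at hb
    obtain ⟨y, hy⟩ := hb
    rcases h (show (c, y ⊔ b) ∈ boxUnion c d l from Or.inl le_rfl) with h1 | h1 | h1
    · exact hy (le_sup_left.trans h1.2)
    · exact hz c h1
    · exact hy (le_sup_left.trans (h1 b))
  by_cases hzA : ∃ z : A, IsBot z <;> by_cases hzB : ∃ z : B, IsBot z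
  · obtain ⟨z, hz⟩ := hzA
    obtain ⟨w, hw⟩ := hzB
    have : pureTensor a b = box a w ∩ box z b := by
      ext ⟨x, y⟩
      simp only [pureTensor, botSet, box, Set.mem_union, Set.mem_inter_iff, Set.mem_ofPred_eq,
        isBot_iff_le hz, isBot_iff_le hw]
      have h1 : x ≤ z → x ≤ a := fun h => h.trans (hz a)
      have h2 : y ≤ w → y ≤ b := fun h => h.trans (hw b)
      tauto
    rw [this]
    exact (isBoxMeet_box _ _).inter (isBoxMeet_box _ _)
  · have ha := hA.resolve_left hzB
    obtain ⟨z, hz⟩ := hzA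
    have : pureTensor a b = box z b := by
      ext ⟨x, y⟩
      have h1 : ¬ IsBot y := fun h => hzB ⟨y, h⟩
      have h2 := ha x
      simp only [pureTensor, botSet, box, Set.mem_union, Set.mem_ofPred_eq, isBot_iff_le hz]
      tauto
    rw [this]
    exact isBoxMeet_box _ _
  · have hb := hB.resolve_left hzA
    obtain ⟨w, hw⟩ := hzB
    have : pureTensor a b = box a w := by
      ext ⟨x, y⟩
      have h1 : ¬ IsBot x := fun h => hzA ⟨x, h⟩
      have h2 := hb y
      simp only [pureTensor, botSet, box, Set.mem_union, Set.mem_ofPred_eq, isBot_iff_le hw]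
      tauto
    rw [this]
    exact isBoxMeet_box _ _
  · have ha := hA.resolve_left hzB
    have hb := hB.resolve_left hzA
    have : pureTensor a b = box a b := by
      ext ⟨x, y⟩
      exact ⟨fun _ => Or.inl (ha x), fun _ => Or.inl ⟨ha x, hb y⟩⟩
    rw [this]
    exact isBoxMeet_box _ _

theorem pureTensor_mono {a a' : A} {b b' : B} (ha : a ≤ a') (hb : b ≤ b') :
    pureTensor a b ⊆ pureTensor a' b' :=
  Set.union_subset_union_left _ fun _ h => ⟨h.1.trans ha, h.2.trans hb⟩

variable (A B) in
/-- The lattice tensor product `A ⊠ B`: the set of all confined members of `A □ B`. -/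
abbrev LatticeTensor : Type (max u v) := {H : BoxProduct A B // IsConfined H.1}

theorem IsConfined.sup {H K : BoxProduct A B} (hH : IsConfined H.1) (hK : IsConfined K.1) :
    IsConfined (H ⊔ K).1 := by
  obtain ⟨a, b, h⟩ := hH
  obtain ⟨c, d, k⟩ := hK
  have h' := h.trans (pureTensor_mono (le_sup_left : a ≤ a ⊔ c) (le_sup_left : b ≤ b ⊔ d))
  have k' := k.trans (pureTensor_mono (le_sup_right : c ≤ a ⊔ c) (le_sup_right : d ≤ b ⊔ d))
  have hT := isBoxMeet_pureTensor H.2 h'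
  have h1 : H ≤ ⟨_, hT⟩ := h'
  have h2 : K ≤ ⟨_, hT⟩ := k'
  exact ⟨_, _, sup_le h1 h2⟩

/-- The lattice tensor product, as a sublattice of the box product. -/
instance : Lattice (LatticeTensor A B) :=
  Subtype.lattice (fun _ _ h k => h.sup k)
    (fun _ _ h _ => h.imp fun _ h => h.imp fun _ h => Set.inter_subset_left.trans h)

end Basic

/-- A lattice is simple if it has more than one element and its only congruences are the equality
relation and the full relation. -/
def IsSimpleLattice (S : Type u) [Lattice S] : Prop :=
  Nontrivial S ∧ ∀ θ : LatticeCon S, (∀ x y, θ.r x y ↔ x = y) ∨ (∀ x y, θ.r x y)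

/-- A lattice homomorphism `f` is a congruence-preserving embedding if it is injective and, for
every congruence `α` of the domain, exactly one congruence `β` of the codomain extends `α` along
`f`. -/
def IsCongruencePreservingEmbedding {L : Type u} {K : Type v} [Lattice L] [Lattice K]
    (f : LatticeHom L K) : Prop :=
  Function.Injective f ∧
    ∀ α : LatticeCon L, ∃! β : LatticeCon K, ∀ x y, β.r (f x) (f y) ↔ α.r x y

end LatTensor

namespace LatTensor

universe u v

/-! ### Saturation by a congruence of the second factor, and the induced congruence -/

section Saturation

variable {A : Type u} {B : Type v} [Lattice A] [Lattice B]

/-! Both maps have the form `x ↦ c ⊠ x` with `c ≠ ⊥`, since `⊥ □ x = ⊤ ⊠ x`; one argument covers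
both.

Existence: for a congruence `α` of the second factor, call two members of `A ⊠ B` congruent when
their `α`-saturations agree. Saturation commutes with meets. For joins, the point is
`IsBoxMeet.exists_subset_box`: finite generation lets a member inside the saturation of `p □ q` fit
in `p □ q'` with `q'` congruent to `q`, unless `q` is a top modulo `α`.

Uniqueness: let `β` restrict to `α` along `s ⊠ x`. As `a` runs from `⊥` to `c`, the set `(a □ b) ∩
(c ⊠ b')` moves from `c ⊠ (b ⊓ b')` to `c ⊠ b'`. Pulling `β` back along these cuts gives a
congruence of `A` (`fstCon`). By simplicity, identifying one pair `a ≠ a'` identifies all pairs. So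
a collapse anywhere in the first coordinate is visible at `s` (`subset_saturate_of_r`), and a
collapse at `s` spreads to every `c` (`tensor_r_tensor`, `inf_r_of_subset_saturate`). Hence `β` is
the saturation congruence. -/

theorem IsBoxMeet.mem_of_le {H : Set (A × B)} (hH : IsBoxMeet H) {x x' : A} {y y' : B}
    (h : (x, y) ∈ H) (hx : x' ≤ x) (hy : y' ≤ y) : (x', y') ∈ H := by
  obtain ⟨t, -, rfl⟩ := hH
  rw [Set.mem_iInter₂] at h ⊢
  exact fun p hp => (h p hp).imp hx.trans hy.trans

theorem IsBoxMeet.sup_fst_mem {H : Set (A × B)} (hH : IsBoxMeet H) {x x' : A} {y : B}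
    (h : (x, y) ∈ H) (h' : (x', y) ∈ H) : (x ⊔ x', y) ∈ H := by
  obtain ⟨t, -, rfl⟩ := hH
  rw [Set.mem_iInter₂] at h h' ⊢
  intro p hp
  rcases h p hp with h1 | h1
  · exact (h' p hp).imp_left (sup_le h1)
  · exact Or.inr h1

theorem IsBoxMeet.sup_snd_mem {H : Set (A × B)} (hH : IsBoxMeet H) {x : A} {y y' : B}
    (h : (x, y) ∈ H) (h' : (x, y') ∈ H) : (x, y ⊔ y') ∈ H := by
  obtain ⟨t, -, rfl⟩ := hH
  rw [Set.mem_iInter₂] at h h' ⊢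
  intro p hp
  rcases h p hp with h1 | h1
  · exact Or.inl h1
  · exact (h' p hp).imp_right (sup_le h1)

/-- The saturation of a set of pairs under a congruence of the second factor. -/
def saturate (α : LatticeCon B) (H : Set (A × B)) : Set (A × B) :=
  {p | ∃ y, α.r p.2 y ∧ (p.1, y) ∈ H}

theorem subset_saturate {A : Type u} {B : Type v} [Lattice B] (α : LatticeCon B)
    (H : Set (A × B)) : H ⊆ saturate α H :=
  fun p hp => ⟨p.2, α.refl _, hp⟩

theorem saturate_subset_iff {A : Type u} {B : Type v} [Lattice B] {α : LatticeCon B}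
    {H K : Set (A × B)} :
    saturate α H ⊆ saturate α K ↔ H ⊆ saturate α K := by
  refine ⟨(subset_saturate α H).trans, ?_⟩
  rintro h p ⟨y, hy, hp⟩
  obtain ⟨z, hz, hp⟩ := h hp
  exact ⟨z, α.trans hy hz, hp⟩

theorem saturate_eq_iff {A : Type u} {B : Type v} [Lattice B] {α : LatticeCon B} {H K : Set (A × B)} :
    saturate α H = saturate α K ↔ H ⊆ saturate α K ∧ K ⊆ saturate α H := by
  rw [Set.Subset.antisymm_iff, saturate_subset_iff, saturate_subset_iff]

theorem mem_saturate_inter {α : LatticeCon B} {H K : Set (A × B)} (hH : IsBoxMeet H)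
    (hK : IsBoxMeet K) {p : A × B} (h : p ∈ saturate α H) (k : p ∈ saturate α K) :
    p ∈ saturate α (H ∩ K) := by
  obtain ⟨y, hy, hpy⟩ := h
  obtain ⟨z, hz, hpz⟩ := k
  exact ⟨y ⊓ z, by simpa using α.inf hy hz, hH.mem_of_le hpy le_rfl inf_le_left,
    hK.mem_of_le hpz le_rfl inf_le_right⟩

theorem saturate_inter {α : LatticeCon B} {H K : Set (A × B)} (hH : IsBoxMeet H)
    (hK : IsBoxMeet K) : saturate α (H ∩ K) = saturate α H ∩ saturate α K := by
  refine Set.Subset.antisymm (fun p hp => ?_) fun p hp => mem_saturate_inter hH hK hp.1 hp.2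
  obtain ⟨y, hy, h, k⟩ := hp
  exact ⟨⟨y, hy, h⟩, ⟨y, hy, k⟩⟩

theorem mem_saturate_biInter {α : LatticeCon B} {t : Finset (A × B)} (ht : t.Nonempty)
    {z : A × B} (h : ∀ p ∈ t, z ∈ saturate α (box p.1 p.2)) :
    z ∈ saturate α (⋂ p ∈ t, box p.1 p.2) := by
  induction ht using Finset.Nonempty.cons_induction with
  | singleton p => simpa using h p
  | cons p s hp hs ih =>
    simp only [Finset.mem_cons, forall_eq_or_imp] at h
    simp only [Finset.mem_cons, Set.iInter_iInter_eq_or_left]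
    exact mem_saturate_inter (isBoxMeet_box _ _) ⟨s, hs, rfl⟩ h.1 (ih h.2)

theorem mem_saturate_box {α : LatticeCon B} {a x : A} {b y : B} :
    (x, y) ∈ saturate α (box a b) ↔ x ≤ a ∨ α.r (y ⊓ b) y := by
  constructor
  · rintro ⟨z, hz, h | h⟩
    · exact Or.inl h
    · have h1 : z ⊓ b = z := inf_eq_left.2 h
      have h2 := α.inf hz (α.refl b)
      rw [h1] at h2
      exact Or.inr (α.trans h2 (α.symm hz))
  · rintro (h | h)
    · exact ⟨y, α.refl y, Or.inl h⟩
    · exact ⟨y ⊓ b, α.symm h, Or.inr inf_le_right⟩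

theorem r_sup_of_r_inf {α : LatticeCon B} {b y : B} (h : α.r (y ⊓ b) y) :
    α.r b (b ⊔ y) := by
  simpa [sup_comm, inf_comm] using α.sup h (α.refl b)

/-- A member of the box product that lies in the saturation of a box lies in an equivalent box,
unless the saturation is everything. -/
theorem IsBoxMeet.exists_subset_box {α : LatticeCon B} {H : Set (A × B)} (hH : IsBoxMeet H)
    {p : A} {q : B} (h : H ⊆ saturate α (box p q)) :
    (∀ y, α.r (y ⊓ q) y) ∨ ∃ q', q ≤ q' ∧ α.r q q' ∧ H ⊆ box p q' := by
  obtain ⟨a, b, l, rfl⟩ := hH.exists_boxUnion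
  by_cases hp : IsTop p
  · exact Or.inr ⟨q, le_rfl, α.refl q, fun z _ => Or.inl (hp _)⟩
  by_cases hq : ∀ y, α.r (y ⊓ q) y
  · exact Or.inl hq
  right
  simp only [IsTop, not_forall] at hp hq
  obtain ⟨x, hx⟩ := hp
  obtain ⟨y, hy⟩ := hq
  -- The points `(a, y)` and `(x, b)` lie in the member, while `y` and `x` each rule out one
  -- alternative.
  have ha : a ≤ p := (mem_saturate_box.1 (h (show (a, y) ∈ _ from Or.inl le_rfl))).resolve_right hy
  have hb : α.r (b ⊓ q) b :=
    (mem_saturate_box.1 (h (show (x, b) ∈ _ from Or.inr (Or.inl le_rfl)))).resolve_left hx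
  have hl : ∀ c ∈ l, c.1 ≤ p ∨ α.r (c.2 ⊓ q) c.2 := fun c hc =>
    mem_saturate_box.1 (h (show c ∈ _ from Or.inr (Or.inr ⟨c, hc, le_rfl, le_rfl⟩)))
  -- Each of the finitely many rectangles not below `p` has its second side joined to `q`, which
  -- stays in the class of `q`.
  have key : ∃ q', q ≤ q' ∧ α.r q q' ∧ ∀ c ∈ l, c.1 ≤ p ∨ c.2 ≤ q' := by
    clear h hH
    induction l with
    | nil => exact ⟨q, le_rfl, α.refl q, by simp⟩
    | cons d l ih =>
      simp only [List.mem_cons, forall_eq_or_imp] at hl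
      obtain ⟨q', h1, h2, h3⟩ := ih hl.2
      rcases hl.1 with h4 | h4
      · refine ⟨q', h1, h2, ?_⟩
        simp only [List.mem_cons, forall_eq_or_imp]
        exact ⟨Or.inl h4, h3⟩
      · refine ⟨q' ⊔ d.2, le_sup_of_le_left h1, ?_, ?_⟩
        · have h5 := α.sup h2 (r_sup_of_r_inf h4)
          rw [sup_idem, ← sup_assoc, sup_eq_left.2 h1] at h5
          exact h5
        · simp only [List.mem_cons, forall_eq_or_imp]
          exact ⟨Or.inr le_sup_right, fun c hc => (h3 c hc).imp_right le_sup_of_le_left⟩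
  obtain ⟨q', h1, h2, h3⟩ := key
  refine ⟨q' ⊔ b, le_sup_of_le_left h1, ?_, boxUnion_subset_box.2
    (Or.inr (Or.inr ⟨ha, le_sup_right, fun c hc => (h3 c hc).imp_right le_sup_of_le_left⟩))⟩
  have h5 := α.sup h2 (r_sup_of_r_inf hb)
  rwa [sup_idem, ← sup_assoc, sup_eq_left.2 h1] at h5

/-- It suffices to test the boxes `p □ b` that cut out `H' ⊔ K'`. Unless `b` is a top modulo `α`,
`H` and `K` lie in `p □ q` and `p □ r` with `q`, `r` congruent to `b`, so their join lies in `p □ (q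
⊔ r)`. -/
theorem sup_subset_saturate {α : LatticeCon B} {H K H' K' : BoxProduct A B}
    (hH : H.1 ⊆ saturate α H'.1) (hK : K.1 ⊆ saturate α K'.1) :
    (H ⊔ K).1 ⊆ saturate α (H' ⊔ K').1 := by
  obtain ⟨t, ht, h⟩ := (H' ⊔ K').2
  have hH' : H'.1 ⊆ (H' ⊔ K').1 := (le_sup_left : H' ≤ H' ⊔ K')
  have hK' : K'.1 ⊆ (H' ⊔ K').1 := (le_sup_right : K' ≤ H' ⊔ K')
  have hmono : ∀ {M N : Set (A × B)}, M ⊆ N → saturate α M ⊆ saturate α N :=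
    fun hMN => saturate_subset_iff.2 (hMN.trans (subset_saturate α _))
  intro z hz
  rw [h]
  refine mem_saturate_biInter ht fun p hp => ?_
  have hbox : (H' ⊔ K').1 ⊆ box p.1 p.2 := h ▸ Set.biInter_subset_of_mem
    (t := fun p : A × B => box p.1 p.2) hp
  rcases H.2.exists_subset_box (hH.trans (hmono (hH'.trans hbox))) with h1 | ⟨q, h1, h2, h3⟩
  · exact mem_saturate_box.2 (Or.inr (h1 _))
  rcases K.2.exists_subset_box (hK.trans (hmono (hK'.trans hbox))) with k1 | ⟨r, k1, k2, k3⟩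
  · exact mem_saturate_box.2 (Or.inr (k1 _))
  have hz' : z ∈ box p.1 (q ⊔ r) := by
    have h4 : H ≤ ⟨_, isBoxMeet_box p.1 (q ⊔ r)⟩ :=
      h3.trans fun _ h => h.imp_right le_sup_of_le_left
    have h5 : K ≤ ⟨_, isBoxMeet_box p.1 (q ⊔ r)⟩ :=
      k3.trans fun _ h => h.imp_right le_sup_of_le_right
    exact sup_le h4 h5 hz
  refine mem_saturate_box.2 (hz'.imp_right fun h6 => ?_)
  have h7 := α.inf (α.refl z.2) (α.sup h2 k2)
  rwa [sup_idem, inf_eq_left.2 h6] at h7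

variable (A) in
/-- The congruence of `A ⊠ B` that a congruence of `B` induces. -/
def tensorCon (α : LatticeCon B) : LatticeCon (LatticeTensor A B) where
  r H K := saturate α H.1.1 = saturate α K.1.1
  iseqv := ⟨fun _ => rfl, Eq.symm, Eq.trans⟩
  inf {H H' K K'} h k := by
    have e : ∀ M N : LatticeTensor A B,
        saturate α (M ⊓ N).1.1 = saturate α M.1.1 ∩ saturate α N.1.1 :=
      fun M N => saturate_inter M.1.2 N.1.2
    rw [e, e, h, k]
  sup {H H' K K'} h k := by
    rw [saturate_eq_iff] at h k ⊢
    exact ⟨sup_subset_saturate h.1 k.1, sup_subset_saturate h.2 k.2⟩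

end Saturation

/-! ### Pure tensors and their cuts by boxes -/

section Tensors

variable {A : Type u} {B : Type v} [Lattice A] [Lattice B]

variable (B) in
/-- The condition on `c` under which, in the presence of a zero of `A`, the sets `c ⊠ b` belong to
the box product. -/
def IsTensorable (c : A) : Prop := IsTop c ∨ ∃ z : B, IsBot z

theorem IsTensorable.mono {c c' : A} (hc : IsTensorable B c) (h : c ≤ c') : IsTensorable B c' :=
  hc.imp_left fun hc x => (hc x).trans h

/-- A member contains a full row `A × {d}`. If the bound `a` is not a top, the part of the row
outside `a` must lie in `⊥_{A,B}`, which makes `d` a zero. -/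
theorem exists_isTensorable (H : LatticeTensor A B) :
    ∃ (c : A) (m : B), IsTensorable B c ∧ H.1.1 ⊆ pureTensor c m := by
  obtain ⟨a, b, h⟩ := H.2
  obtain ⟨c, d, l, e⟩ := H.1.2.exists_boxUnion
  refine ⟨a, b, ?_, h⟩
  by_contra hc
  simp only [IsTensorable, IsTop, not_or, not_forall] at hc
  obtain ⟨⟨x, hx⟩, hz⟩ := hc
  rw [e] at h
  rcases h (show (x ⊔ a, d) ∈ boxUnion c d l from Or.inr (Or.inl le_rfl)) with h1 | h1 | h1
  · exact hx (le_sup_left.trans h1.1)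
  · exact hx (le_sup_left.trans (h1 a))
  · exact hz ⟨d, h1⟩

/-- The meet of a member of `A ⊠ B` and a box. -/
def capBox (H : LatticeTensor A B) (a : A) (b : B) : LatticeTensor A B :=
  ⟨⟨H.1.1 ∩ box a b, H.1.2.inter (isBoxMeet_box a b)⟩,
    H.2.imp fun _ => Exists.imp fun _ h => Set.inter_subset_left.trans h⟩

theorem capBox_mono {G H : LatticeTensor A B} (h : G ≤ H) {a a' : A} (ha : a ≤ a') (b : B) :
    capBox G a b ≤ capBox H a' b :=
  fun _ hz => ⟨h hz.1, hz.2.imp_left fun h => h.trans ha⟩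

theorem capBox_inf (H : LatticeTensor A B) (a a' : A) (b : B) :
    capBox H (a ⊓ a') b = capBox H a b ⊓ capBox H a' b := by
  refine le_antisymm (le_inf (capBox_mono le_rfl inf_le_left b)
    (capBox_mono le_rfl inf_le_right b)) ?_
  rintro z ⟨⟨h1, h2⟩, -, h3⟩
  refine ⟨h1, ?_⟩
  rcases h2 with h2 | h2
  · exact h3.imp_left (le_inf h2)
  · exact Or.inr h2

theorem capBox_eq_inf {G H : LatticeTensor A B} (h : G ≤ H) (a : A) (b : B) :
    capBox G a b = capBox H a b ⊓ G :=
  le_antisymm (le_inf (capBox_mono h le_rfl b) Set.inter_subset_left) fun _ hz => ⟨hz.2, hz.1.2⟩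

theorem botSet_subset (H : LatticeTensor A B) : botSet A B ⊆ H.1.1 := by
  obtain ⟨t, -, h⟩ := H.1.2
  rw [h]
  exact fun z hz => Set.mem_iInter₂.2 fun p _ => hz.imp (fun h => h p.1) fun h => h p.2

variable [OrderBot A]

theorem pureTensor_of_isTop {c : A} (hc : IsTop c) (b : B) : pureTensor c b = box ⊥ b := by
  ext ⟨x, y⟩
  have h1 : IsBot y → y ≤ b := fun h => h b
  have h2 := hc x
  simp only [pureTensor, botSet, box, Set.mem_union, Set.mem_ofPred_eq, isBot_iff_le isBot_bot]
  tauto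

theorem IsTensorable.isBoxMeet {c : A} (hc : IsTensorable B c) (b : B) :
    IsBoxMeet (pureTensor c b) := by
  rcases hc with hc | ⟨z, hz⟩
  · rw [pureTensor_of_isTop hc]
    exact isBoxMeet_box _ _
  · have : pureTensor c b = box c z ∩ box ⊥ b := by
      ext ⟨x, y⟩
      simp only [pureTensor, botSet, box, Set.mem_union, Set.mem_inter_iff, Set.mem_ofPred_eq,
        isBot_iff_le isBot_bot, isBot_iff_le hz]
      have h1 : x ≤ ⊥ → x ≤ c := fun h => h.trans bot_le
      have h2 : y ≤ z → y ≤ b := fun h => h.trans (hz b)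
      tauto
    rw [this]
    exact (isBoxMeet_box _ _).inter (isBoxMeet_box _ _)

/-- The element `c ⊠ b` of `A ⊠ B`. -/
def tensor {c : A} (hc : IsTensorable B c) (b : B) : LatticeTensor A B :=
  ⟨⟨pureTensor c b, hc.isBoxMeet b⟩, c, b, subset_rfl⟩

theorem tensor_le {c : A} (hc : IsTensorable B c) {b : B} {H : LatticeTensor A B} :
    tensor hc b ≤ H ↔ (c, b) ∈ H.1.1 :=
  ⟨fun h => h (Or.inl ⟨le_rfl, le_rfl⟩), fun h => Set.union_subset
    (fun _ hz => H.1.2.mem_of_le h hz.1 hz.2) (botSet_subset H)⟩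

theorem tensor_mono {c c' : A} (hc : IsTensorable B c) (hc' : IsTensorable B c') {b b' : B}
    (h : c ≤ c') (h' : b ≤ b') : tensor hc b ≤ tensor hc' b' :=
  pureTensor_mono h h'

theorem tensor_inf {c : A} (hc : IsTensorable B c) (b b' : B) :
    tensor hc (b ⊓ b') = tensor hc b ⊓ tensor hc b' := by
  refine le_antisymm (le_inf (tensor_mono hc hc le_rfl inf_le_left)
    (tensor_mono hc hc le_rfl inf_le_right)) ?_
  rintro z ⟨h1 | h1, h2 | h2⟩
  · exact Or.inl ⟨h1.1, le_inf h1.2 h2.2⟩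
  all_goals right; assumption

theorem tensor_sup {c : A} (hc : IsTensorable B c) (b b' : B) :
    tensor hc (b ⊔ b') = tensor hc b ⊔ tensor hc b' :=
  le_antisymm ((tensor_le hc).2 (IsBoxMeet.sup_snd_mem (Subtype.prop _)
    ((tensor_le hc).1 le_sup_left) ((tensor_le hc).1 le_sup_right)))
    (sup_le (tensor_mono hc hc le_rfl le_sup_left) (tensor_mono hc hc le_rfl le_sup_right))

/-- The bounds by `c` put `(a, b')` and `(a', b')` in the two cuts, and members are closed under
joins in the first coordinate. -/
theorem capBox_sup {c : A} (hc : IsTensorable B c) {a a' : A} (ha : a ≤ c) (ha' : a' ≤ c)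
    (b b' : B) : capBox (tensor hc b') (a ⊔ a') b =
      capBox (tensor hc b') a b ⊔ capBox (tensor hc b') a' b := by
  refine le_antisymm ?_
    (sup_le (capBox_mono le_rfl le_sup_left b) (capBox_mono le_rfl le_sup_right b))
  set M := capBox (tensor hc b') a b ⊔ capBox (tensor hc b') a' b
  have h1 : capBox (tensor hc b') a b ≤ M := le_sup_left
  have h2 : capBox (tensor hc b') a' b ≤ M := le_sup_right
  rintro z ⟨h3 | h3, h4⟩
  · rcases h4 with h4 | h4
    · have h5 : (a, b') ∈ M.1.1 := h1 ⟨Or.inl ⟨ha, le_rfl⟩, Or.inl le_rfl⟩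
      have h6 : (a', b') ∈ M.1.1 := h2 ⟨Or.inl ⟨ha', le_rfl⟩, Or.inl le_rfl⟩
      exact M.1.2.mem_of_le (M.1.2.sup_fst_mem h5 h6) h4 h3.2
    · exact h1 ⟨Or.inl h3, Or.inr h4⟩
  · exact botSet_subset M h3

theorem capBox_tensor_bot {c : A} (hc : IsTensorable B c) (b b' : B) :
    capBox (tensor hc b') ⊥ b = tensor hc (b ⊓ b') := by
  apply le_antisymm
  · rintro z ⟨h | h, h1 | h1⟩
    · exact Or.inr (Or.inl ((isBot_iff_le isBot_bot).2 h1))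
    · exact Or.inl ⟨h.1, le_inf h1 h.2⟩
    all_goals exact Or.inr h
  · rw [tensor_le]
    exact ⟨Or.inl ⟨le_rfl, inf_le_right⟩, Or.inr inf_le_left⟩

theorem capBox_tensor_self {c : A} (hc : IsTensorable B c) (b b' : B) :
    capBox (tensor hc b') c b = tensor hc b' :=
  le_antisymm Set.inter_subset_left
    ((tensor_le hc).2 ⟨Or.inl ⟨le_rfl, le_rfl⟩, Or.inl le_rfl⟩)

/-- The map `x ↦ c ⊠ x` as a lattice homomorphism. -/
def tensorHom {c : A} (hc : IsTensorable B c) : LatticeHom B (LatticeTensor A B) where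
  toFun := tensor hc
  map_sup' := tensor_sup hc
  map_inf' := tensor_inf hc

theorem tensor_le_tensor {c : A} (hc : IsTensorable B c) (h : c ≠ ⊥) {x y : B} :
    tensor hc x ≤ tensor hc y ↔ x ≤ y := by
  refine ⟨fun h1 => ?_, tensor_mono hc hc le_rfl⟩
  rcases (tensor_le hc).1 h1 with h2 | h2 | h2
  · exact h2.2
  · exact absurd ((isBot_iff_le isBot_bot).1 h2) (by simpa using h)
  · exact h2 y

theorem tensor_subset_saturate {α : LatticeCon B} {c : A} (hc : IsTensorable B c) (h : c ≠ ⊥)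
    {x y : B} : (tensor hc x).1.1 ⊆ saturate α (tensor hc y).1.1 ↔ α.r (x ⊓ y) x := by
  constructor
  · intro h1
    obtain ⟨z, hz, h2⟩ := h1 (show (c, x) ∈ _ from Or.inl ⟨le_rfl, le_rfl⟩)
    have h3 : z ≤ y := by
      rcases h2 with h2 | h2 | h2
      · exact h2.2
      · exact absurd ((isBot_iff_le isBot_bot).1 h2) (by simpa using h)
      · exact h2 y
    have h4 := α.inf hz (α.refl y)
    rw [inf_eq_left.2 h3] at h4
    exact α.trans h4 (α.symm hz)
  · rintro h1 z (h2 | h2)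
    · refine ⟨z.2 ⊓ y, ?_, Or.inl ⟨h2.1, inf_le_right⟩⟩
      have h3 := α.inf (α.refl z.2) h1
      rw [← inf_assoc, inf_eq_left.2 h2.2] at h3
      exact α.symm h3
    · exact ⟨z.2, α.refl _, Or.inr h2⟩

theorem tensorCon_tensorHom {α : LatticeCon B} {c : A} (hc : IsTensorable B c) (h : c ≠ ⊥)
    (x y : B) : (tensorCon A α).r (tensorHom hc x) (tensorHom hc y) ↔ α.r x y := by
  change saturate α (tensor hc x).1.1 = saturate α (tensor hc y).1.1 ↔ _
  rw [saturate_eq_iff, tensor_subset_saturate hc h, tensor_subset_saturate hc h]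
  constructor
  · rintro ⟨h1, h2⟩
    rw [inf_comm] at h2
    exact α.trans (α.symm h1) h2
  · intro h1
    have h2 := α.inf (α.refl x) h1
    have h3 := α.inf (α.refl y) h1
    rw [inf_idem] at h2 h3
    exact ⟨α.symm h2, h3⟩

end Tensors

/-! ### Simplicity of the first factor and uniqueness of the extension -/

section Uniqueness

variable {A : Type u} {B : Type v} [Lattice A] [Lattice B] [OrderBot A]

theorem capBox_tensor_eq_inf {c c' : A} (hc : IsTensorable B c) (hc' : IsTensorable B c')
    (h : c ≤ c') {m m' : B} (h' : m ≤ m') (a : A) (b : B) :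
    capBox (tensor hc m) a b = capBox (tensor hc' m') a b ⊓ tensor hc m :=
  capBox_eq_inf (tensor_mono hc hc' h h') a b

/-- The congruence of `A` that consists of the pairs `(a, a')` for which a congruence of `A ⊠ B`
identifies `(a □ b) ∩ (c ⊠ b')` and `(a' □ b) ∩ (c ⊠ b')` for all `c`. -/
def fstCon (β : LatticeCon (LatticeTensor A B)) (b b' : B) : LatticeCon A where
  r a a' := ∀ c (hc : IsTensorable B c),
    β.r (capBox (tensor hc b') a b) (capBox (tensor hc b') a' b)
  iseqv := ⟨fun _ _ _ => β.refl _, fun h c hc => β.symm (h c hc),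
    fun h h' c hc => β.trans (h c hc) (h' c hc)⟩
  inf {w x y z} h h' c hc := by
    rw [capBox_inf, capBox_inf]
    exact β.inf (h c hc) (h' c hc)
  sup {w x y z} h h' c hc := by
    -- Cuts preserve joins only below `c`, so `c` is enlarged and the result is met with `c ⊠ b'`.
    -- This is why the relation quantifies over all `c`.
    have hle : c ≤ c ⊔ (w ⊔ x ⊔ (y ⊔ z)) := le_sup_left
    have hd := hc.mono hle
    have hw : w ≤ c ⊔ (w ⊔ x ⊔ (y ⊔ z)) :=
      le_sup_of_le_right (le_sup_of_le_left le_sup_left)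
    have hx : x ≤ c ⊔ (w ⊔ x ⊔ (y ⊔ z)) :=
      le_sup_of_le_right (le_sup_of_le_left le_sup_right)
    have hy : y ≤ c ⊔ (w ⊔ x ⊔ (y ⊔ z)) :=
      le_sup_of_le_right (le_sup_of_le_right le_sup_left)
    have hz : z ≤ c ⊔ (w ⊔ x ⊔ (y ⊔ z)) :=
      le_sup_of_le_right (le_sup_of_le_right le_sup_right)
    rw [capBox_tensor_eq_inf hc hd hle le_rfl, capBox_tensor_eq_inf hc hd hle le_rfl (x ⊔ z),
      capBox_sup hd hw hy, capBox_sup hd hx hz]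
    exact β.inf (β.sup (h _ hd) (h' _ hd)) (β.refl _)

theorem IsSimpleLattice.r_of_ne {S : Type u} [Lattice S] (hS : IsSimpleLattice S)
    {θ : LatticeCon S} {x y : S} (h : θ.r x y) (hxy : x ≠ y) (z w : S) : θ.r z w := by
  rcases hS.2 θ with h1 | h1
  · exact absurd ((h1 x y).1 h) hxy
  · exact h1 z w

variable {α : LatticeCon B} {β : LatticeCon (LatticeTensor A B)} {s : A}

theorem r_inf_of_fstCon (hs : IsTensorable B s)
    (hαβ : ∀ x y, β.r (tensor hs x) (tensor hs y) ↔ α.r x y) {b b' : B}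
    (h : (fstCon β b b').r ⊥ s) : α.r (b ⊓ b') b' := by
  have h1 := h s hs
  rwa [capBox_tensor_bot, capBox_tensor_self, hαβ] at h1

theorem fstCon_of_r (hs : IsTensorable B s)
    (hαβ : ∀ x y, β.r (tensor hs x) (tensor hs y) ↔ α.r x y) {b b' : B} (hb : b ≤ b')
    (h : α.r b b') : (fstCon β b b').r ⊥ s := by
  intro c hc
  have hd := hc.mono (le_sup_left : c ≤ c ⊔ s)
  rw [capBox_tensor_eq_inf hc hd le_sup_left le_rfl ⊥,
    capBox_tensor_eq_inf hc hd le_sup_left le_rfl s]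
  refine β.inf ?_ (β.refl _)
  -- The cut at `s` adds only `s ⊠ b'` to the cut at `⊥`, and `β` identifies `s ⊠ b` with `s ⊠ b'`.
  have e : capBox (tensor hd b') s b = tensor hd b ⊔ tensor hs b' := by
    apply le_antisymm
    · have h1 : tensor hd b ≤ tensor hd b ⊔ tensor hs b' := le_sup_left
      have h2 : tensor hs b' ≤ tensor hd b ⊔ tensor hs b' := le_sup_right
      rintro z ⟨h3 | h3, h4 | h4⟩
      · exact h2 (Or.inl ⟨h4, h3.2⟩)
      · exact h1 (Or.inl ⟨h3.1, h4⟩)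
      all_goals exact botSet_subset _ h3
    · refine sup_le ((tensor_le hd).2 ⟨Or.inl ⟨le_rfl, hb⟩, Or.inr le_rfl⟩)
        ((tensor_le hs).2 ⟨Or.inl ⟨le_sup_right, le_rfl⟩, Or.inl le_rfl⟩)
  rw [capBox_tensor_bot, inf_eq_left.2 hb, e]
  have h1 := β.sup (β.refl (tensor hd b)) ((hαβ b b').2 h)
  rwa [sup_eq_left.2 (tensor_mono hs hd le_sup_right le_rfl)] at h1

theorem tensor_r_tensor (hA : IsSimpleLattice A) (hs : IsTensorable B s) (hs0 : s ≠ ⊥)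
    (hαβ : ∀ x y, β.r (tensor hs x) (tensor hs y) ↔ α.r x y) {b b' : B} (hb : b ≤ b')
    (h : α.r b b') {c : A} (hc : IsTensorable B c) : β.r (tensor hc b) (tensor hc b') := by
  have h1 := hA.r_of_ne (fstCon_of_r hs hαβ hb h) hs0.symm ⊥ c c hc
  rwa [capBox_tensor_bot, capBox_tensor_self, inf_eq_left.2 hb] at h1

/-- If `H ⊆ a □ b` and `(x, y) ∈ H'` with `x ≰ a`, then `β` identifies the cuts at `a` and `a ⊔ x`.
Simplicity moves this to `⊥` and `s`, which gives `b ⊓ y` congruent to `y`. -/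
theorem subset_saturate_of_r (hA : IsSimpleLattice A) (hs : IsTensorable B s)
    (hαβ : ∀ x y, β.r (tensor hs x) (tensor hs y) ↔ α.r x y) {H H' : LatticeTensor A B}
    (h : β.r H H') : H'.1.1 ⊆ saturate α H.1.1 := by
  rintro ⟨x, y⟩ hxy
  obtain ⟨t, ht, e⟩ := H.1.2
  rw [e]
  refine mem_saturate_biInter ht ?_
  rintro ⟨a, b⟩ hp
  rw [mem_saturate_box]
  by_cases hxa : x ≤ a
  · exact Or.inl hxa
  right
  have hHp : H.1.1 ⊆ box a b := by
    rw [e]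
    exact Set.biInter_subset_of_mem (t := fun p : A × B => box p.1 p.2) hp
  obtain ⟨c, m, hc, hcm⟩ := exists_isTensorable (H ⊔ H')
  have hH : H ≤ tensor hc m := le_sup_left.trans hcm
  have hH' : H' ≤ tensor hc m := le_sup_right.trans hcm
  rcases hH' hxy with hy | hy | hy
  · rw [inf_comm]
    refine r_inf_of_fstCon hs hαβ (hA.r_of_ne (x := a) (y := a ⊔ x) ?_ ?_ _ _)
    · intro d hd
      have hle : d ≤ d ⊔ (c ⊔ a) := le_sup_left
      have hd' := hd.mono hle
      have hcd : c ≤ d ⊔ (c ⊔ a) := le_sup_of_le_right le_sup_left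
      have had : a ≤ d ⊔ (c ⊔ a) := le_sup_of_le_right le_sup_right
      rw [capBox_tensor_eq_inf hd hd' hle le_rfl a,
        capBox_tensor_eq_inf hd hd' hle le_rfl (a ⊔ x)]
      refine β.inf ?_ (β.refl _)
      set T := capBox (tensor hd' m) a b
      have hHT : H ≤ T := fun z hz => ⟨tensor_mono hc hd' hcd le_rfl (hH hz), hHp hz⟩
      have e1 : capBox (tensor hd' y) a b = T ⊓ tensor hd' y :=
        capBox_tensor_eq_inf hd' hd' le_rfl hy.2 a b
      -- Since `H ≤ T`, replacing `H` by `H'` in `T ⊔ H = T` shows `T` congruent to `T ⊔ H'`. The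
      -- latter contains the cut at `a ⊔ x`, because `(x, y) ∈ H'`.
      have h1 : β.r (capBox (tensor hd' y) a b) ((T ⊔ H') ⊓ tensor hd' y) := by
        have h2 := β.inf (β.sup (β.refl T) h) (β.refl (tensor hd' y))
        rwa [sup_eq_left.2 hHT, ← e1] at h2
      have h2 : capBox (tensor hd' y) (a ⊔ x) b ≤ (T ⊔ H') ⊓ tensor hd' y := by
        rw [capBox_sup hd' had (hy.1.trans hcd)]
        refine sup_le (e1.trans_le (inf_le_inf_right _ le_sup_left))
          (le_inf ?_ Set.inter_subset_left)
        have h3 : T ≤ T ⊔ H' := le_sup_left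
        have h4 : H' ≤ T ⊔ H' := le_sup_right
        rintro z ⟨h5 | h5, h6 | h6⟩
        · exact h4 (H'.1.2.mem_of_le hxy h6 h5.2)
        · exact h3 ⟨Or.inl ⟨h5.1, h5.2.trans hy.2⟩, Or.inr h6⟩
        all_goals exact botSet_subset _ h5
      have h3 := β.inf h1 (β.refl (capBox (tensor hd' y) (a ⊔ x) b))
      rwa [inf_eq_left.2 (capBox_mono le_rfl le_sup_left b), inf_eq_right.2 h2] at h3
    · exact fun h => hxa (h.symm ▸ le_sup_right)
  · exact absurd (hy a) hxa
  · rw [inf_eq_left.2 (hy b)]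

theorem capBox_r_of_subset (hA : IsSimpleLattice A) (hs : IsTensorable B s) (hs0 : s ≠ ⊥)
    (hαβ : ∀ x y, β.r (tensor hs x) (tensor hs y) ↔ α.r x y) {G : LatticeTensor A B} {a : A}
    {b : B} (h : G.1.1 ⊆ saturate α (box a b)) : β.r (capBox G a b) G := by
  obtain ⟨c, m, hc, hcm⟩ := exists_isTensorable G
  have hG : G ≤ tensor hc m := hcm
  obtain ⟨b', h1, h2, h3⟩ : ∃ b', b ≤ b' ∧ α.r b b' ∧ G.1.1 ⊆ box a b' := by
    rcases G.1.2.exists_subset_box h with h1 | h1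
    · refine ⟨b ⊔ m, le_sup_left, r_sup_of_r_inf (h1 m), ?_⟩
      rintro z hz
      rcases hG hz with h2 | h2 | h2
      · exact Or.inr (le_sup_of_le_right h2.2)
      · exact Or.inl (h2 a)
      · exact Or.inr (h2 _)
    · exact h1
  have e : capBox (tensor hc m) a b ⊔ tensor hc (b' ⊓ m) = capBox (tensor hc m) a b' := by
    apply le_antisymm
    · refine sup_le (fun z hz => ⟨hz.1, hz.2.imp_right h1.trans'⟩) ((tensor_le hc).2 ?_)
      exact ⟨Or.inl ⟨le_rfl, inf_le_right⟩, Or.inr inf_le_left⟩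
    · have h4 : capBox (tensor hc m) a b ≤ capBox (tensor hc m) a b ⊔ tensor hc (b' ⊓ m) :=
        le_sup_left
      have h5 : tensor hc (b' ⊓ m) ≤ capBox (tensor hc m) a b ⊔ tensor hc (b' ⊓ m) := le_sup_right
      rintro z ⟨h6 | h6, h7 | h7⟩
      · exact h4 ⟨Or.inl h6, Or.inl h7⟩
      · exact h5 (Or.inl ⟨h6.1, le_inf h7 h6.2⟩)
      all_goals exact botSet_subset _ h6
  have h4 : β.r (capBox (tensor hc m) a b) (capBox (tensor hc m) a b') := by
    have h5 := β.sup (β.refl (capBox (tensor hc m) a b)) (tensor_r_tensor hA hs hs0 hαβ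
      (inf_le_inf_right m h1) (α.inf h2 (α.refl m)) hc)
    have h6 : tensor hc (b ⊓ m) ≤ capBox (tensor hc m) a b := by
      rw [tensor_le]
      exact ⟨Or.inl ⟨le_rfl, inf_le_right⟩, Or.inr inf_le_left⟩
    rwa [sup_eq_left.2 h6, e] at h5
  have h5 := β.inf h4 (β.refl G)
  have h6 : G ≤ capBox (tensor hc m) a b' := fun z hz => ⟨hG hz, h3 hz⟩
  rwa [inf_eq_right.2 h6, ← capBox_eq_inf hG] at h5

/-- `H'` is cut by the finitely many boxes defining `H`, one at a time. Each cut stays in the same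
`β`-class. -/
theorem inf_r_of_subset_saturate (hA : IsSimpleLattice A) (hs : IsTensorable B s) (hs0 : s ≠ ⊥)
    (hαβ : ∀ x y, β.r (tensor hs x) (tensor hs y) ↔ α.r x y) {H H' : LatticeTensor A B}
    (h : H'.1.1 ⊆ saturate α H.1.1) : β.r (H ⊓ H') H' := by
  obtain ⟨t, -, e⟩ := H.1.2
  have key : ∀ r : Finset (A × B), r ⊆ t →
      ∃ G : LatticeTensor A B, G.1.1 = H'.1.1 ∩ (⋂ p ∈ r, box p.1 p.2) ∧ β.r G H' := by
    intro r
    induction r using Finset.cons_induction with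
    | empty => exact fun _ => ⟨H', by simp, β.refl _⟩
    | cons p r hp ih =>
      intro hr
      rw [Finset.cons_subset] at hr
      obtain ⟨G, h1, h2⟩ := ih hr.2
      refine ⟨capBox G p.1 p.2, ?_, β.trans (capBox_r_of_subset hA hs hs0 hαβ ?_) h2⟩
      · change G.1.1 ∩ box p.1 p.2 = _
        rw [h1]
        simp only [Finset.mem_cons, Set.iInter_iInter_eq_or_left]
        rw [Set.inter_assoc, Set.inter_comm (box p.1 p.2)]
      · rw [h1]
        refine (Set.inter_subset_left.trans h).trans (saturate_subset_iff.2
          (Set.Subset.trans ?_ (subset_saturate α _)))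
        rw [e]
        exact Set.biInter_subset_of_mem (t := fun p : A × B => box p.1 p.2) hr.1
  obtain ⟨G, h1, h2⟩ := key t subset_rfl
  have : H ⊓ H' = G := by
    apply Subtype.ext
    apply Subtype.ext
    rw [h1, ← e]
    exact Set.inter_comm _ _
  rwa [this]

/-- A congruence of `A ⊠ B` is determined by its restriction along `x ↦ s ⊠ x`. -/
theorem eq_tensorCon (hA : IsSimpleLattice A) (hs : IsTensorable B s) (hs0 : s ≠ ⊥)
    (hαβ : ∀ x y, β.r (tensorHom hs x) (tensorHom hs y) ↔ α.r x y) : β = tensorCon A α := by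
  have key : ∀ H H', β.r H H' ↔ (tensorCon A α).r H H' := by
    intro H H'
    change _ ↔ saturate α H.1.1 = saturate α H'.1.1
    rw [saturate_eq_iff]
    constructor
    · exact fun h => ⟨subset_saturate_of_r hA hs hαβ (β.symm h), subset_saturate_of_r hA hs hαβ h⟩
    · rintro ⟨h, h'⟩
      have h1 := inf_r_of_subset_saturate hA hs hs0 hαβ h
      rw [inf_comm] at h1
      exact β.trans (β.symm h1) (inf_r_of_subset_saturate hA hs hs0 hαβ h')
  have h : β.toSetoid = (tensorCon A α).toSetoid := Setoid.ext key
  generalize tensorCon A α = γ at h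
  cases β
  cases γ
  cases h
  rfl

theorem isCongruencePreservingEmbedding_tensorHom (hA : IsSimpleLattice A)
    (hs : IsTensorable B s) (hs0 : s ≠ ⊥) : IsCongruencePreservingEmbedding (tensorHom hs) := by
  refine ⟨fun x y h => ?_, fun α => ⟨tensorCon A α, tensorCon_tensorHom hs hs0,
    fun β hβ => eq_tensorCon hA hs hs0 hβ⟩⟩
  have h : tensor hs x = tensor hs y := h
  exact le_antisymm ((tensor_le_tensor hs hs0).1 h.le) ((tensor_le_tensor hs hs0).1 h.ge)

end Uniqueness

end LatTensor

theorem mainTheorem11 {S : Type*} {L : Type*} [Lattice S] [Lattice L]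
    (hS : LatTensor.IsSimpleLattice S) :
    (∀ [BoundedOrder S], ∃ j : LatticeHom L (LatTensor.LatticeTensor S L),
      (∀ x : L, ((j x).1.1 : Set (S × L)) = LatTensor.box (⊥ : S) x) ∧
        LatTensor.IsCongruencePreservingEmbedding j) ∧
    (∀ [OrderBot S] [OrderBot L] (s : S), s ≠ ⊥ →
      ∃ j : LatticeHom L (LatTensor.LatticeTensor S L),
        (∀ x : L, ((j x).1.1 : Set (S × L)) = LatTensor.pureTensor s x) ∧
          LatTensor.IsCongruencePreservingEmbedding j) := by
  constructor
  · intro _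
    have := hS.1
    have hs : LatTensor.IsTensorable L (⊤ : S) := Or.inl isTop_top
    refine ⟨LatTensor.tensorHom hs, fun x => ?_,
      LatTensor.isCongruencePreservingEmbedding_tensorHom hS hs top_ne_bot⟩
    exact LatTensor.pureTensor_of_isTop isTop_top x
  · intro _ _ s hs0
    have hs : LatTensor.IsTensorable L s := Or.inr ⟨⊥, isBot_bot⟩
    exact ⟨LatTensor.tensorHom hs, fun x => rfl,
      LatTensor.isCongruencePreservingEmbedding_tensorHom hS hs hs0⟩
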